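/- Let $\mathbb F_q$ be a finite field. For a field $K$, a linear code of length $n$ over $K$ is a linear subspace of $K^n$. Its minimum distance $d(\cdot)$ is the least Hamming weight of a nonzero codeword (and $n+1$ for the zero code), and an $[n,k,d]$ code is a code of length $n$, dimension $k$ and minimum distance $d$. For codes $A,B$ in $K^n$, $A*B$ denotes the linear span of all coordinatewise products $\mathbf a*\mathbf b$ with $\mathbf a\in A$, $\mathbf b\in B$, and $B^\perp$ is the dual code with respect to $\mathbf x\cdot\mathbf y=\sum_i x_iy_i$. Given an $n$-tuple $\mathbf a$ of pairwise distinct elements of $\mathbb P^1(K)=K\cup\{\infty\}$, an $n$-tuple $\mathbf b$ of nonzero elements of $K$ and $0\le k\le n$, put $$\mathrm{GRS}_k(\mathbf a,\mathbf b)=\{(b_1f(a_1),\dots,b_nf(a_n)) \mid f\in K[X],\ \deg f<k\},$$ where $f(\infty)$ is the coefficient of $X^{k-1}$ in $f$. A code of this form is called a generalized Reed–Solomon (GRS) code over $K$ with evaluation-point sequence $\mathbf a$. Let $t$ and $n$ be integers with $1\le t\le n/2-1$, let $C$ be an $[n,n-2t,2t+1]$ code over $\mathbb F_q$, and let $K$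 be a finite extension of $\mathbb F_q$. Let $A,B\subseteq K^n$ be $K$-linear codes such that $(A,B)$ is a $t$-error-correcting pair for $C$, that is: 1. $\mathbf x\cdot\mathbf c=0$ for all $\mathbf x\in A*B$ and $\mathbf c\in C$; 2. $\dim_K A>t$; 3. $d(B^\perp)>t$; 4. $d(A)+d(C)>n$. Then there is an $n$-tuple $\mathbf a$ of pairwise distinct elements of $\mathbb P^1(\mathbb F_q)$ such that $C$ is a GRS code over $\mathbb F_q$ with evaluation-point sequence $\mathbf a$, and $A$ and $B$ are GRS codes over $K$ with the same evaluation-point sequence $\mathbf a$, viewed in $\mathbb P^1(K)$. Moreover $B=(A*C_K)^\perp$, where $C_K\subseteq K^n$ is the $K$-linear span of $C$. -/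

import Mathlib

namespace ECP

open Polynomial

/-- The minimum distance of a linear code: the least Hamming weight of a nonzero codeword.
The zero code of length `n` has minimum distance `n + 1` by convention; since every weight is at
most `n`, adding `n + 1` to the set of weights changes nothing for nonzero codes. -/
noncomputable def minDist {K : Type*} [Field K] {n : ℕ} (C : Submodule K (Fin n → K)) : ℕ :=
  open Classical in
  sInf (insert (n + 1) {w : ℕ | ∃ c ∈ C, c ≠ 0 ∧ hammingNorm c = w})

/-- `C` is an `[n, k, d]` code. -/
def IsCode {K : Type*} [Field K] {n : ℕ} (C : Submodule K (Fin n → K)) (k d : ℕ) : Prop :=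
  Module.finrank K C = k ∧ minDist C = d

/-- The dual code with respect to the standard inner product. -/
def dualCode {K : Type*} [Field K] {n : ℕ} (C : Submodule K (Fin n → K)) :
    Submodule K (Fin n → K) where
  carrier := {x | ∀ c ∈ C, x ⬝ᵥ c = 0}
  zero_mem' := fun c _ => zero_dotProduct c
  add_mem' := fun hx hy c hc => by rw [add_dotProduct, hx c hc, hy c hc, add_zero]
  smul_mem' := fun r x hx c hc => by rw [smul_dotProduct, hx c hc, smul_zero]

/-- The `K`-linear code generated by the `F`-linear code `C`, for a field extension `K` of `F`. -/
def extend {F : Type*} [Field F] (K : Type*) [Field K] [Algebra F K] {n : ℕ}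
    (C : Submodule F (Fin n → F)) : Submodule K (Fin n → K) :=
  Submodule.span K ((fun c i => algebraMap F K (c i)) '' (C : Set (Fin n → F)))

/-- The value of a polynomial, regarded as an element of the space of polynomials of degree less
than `k`, at a point of the projective line `K ∪ {∞}`. Its value at `∞` is the coefficient
of `X ^ (k - 1)`. -/
noncomputable def evalAt {K : Type*} [Field K] (k : ℕ) : OnePoint K → (K[X] →ₗ[K] K)
  | none => lcoeff K (k - 1)
  | some x => leval x

/-- The evaluation map `f ↦ b * f(a)`. -/
noncomputable def evalMap {K : Type*} [Field K] {n : ℕ} (k : ℕ) (a : Fin n → OnePoint K)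
    (b : Fin n → K) : K[X] →ₗ[K] (Fin n → K) :=
  LinearMap.pi fun i => b i • evalAt k (a i)

/-- The code `GRS_k(a, b)`. -/
noncomputable def GRS {K : Type*} [Field K] {n : ℕ} (k : ℕ) (a : Fin n → OnePoint K)
    (b : Fin n → K) : Submodule K (Fin n → K) :=
  (degreeLT K k).map (evalMap k a b)

/-- `C` is a generalized Reed-Solomon code over `K` with evaluation-point sequence `a`. -/
def IsGRSWith {K : Type*} [Field K] {n : ℕ} (C : Submodule K (Fin n → K))
    (a : Fin n → OnePoint K) : Prop :=
  Function.Injective a ∧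
    ∃ k : ℕ, k ≤ n ∧ ∃ b : Fin n → K, (∀ i, b i ≠ 0) ∧ C = GRS k a b

/-- `(A, B)` is a `t`-error-correcting pair over `K` for the `F`-linear code `C`.
The product `A * B` of submodules of the `K`-algebra `Fin n → K` is the span of all
coordinatewise products `x * y` with `x ∈ A` and `y ∈ B`. -/
structure IsErrorCorrectingPair {F K : Type*} [Field F] [Field K] [Algebra F K] {n : ℕ} (t : ℕ)
    (A B : Submodule K (Fin n → K)) (C : Submodule F (Fin n → F)) : Prop where
  mul_perp : ∀ x ∈ A * B, ∀ c ∈ C, x ⬝ᵥ (fun i => algebraMap F K (c i)) = 0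
  lt_finrank : t < Module.finrank K A
  lt_minDist_dual : t < minDist (dualCode B)
  lt_minDist_add : n < minDist A + minDist C

end ECP

/-! Write n = k + 2t, so that C is MDS of dimension k. Everything rests on zero counting: a word of
`dualCode B` with k + t zeros is 0, and A * C lies in this dual. Multiplying a word of A by a word
of C with k - 1 chosen zeros shows that A is MDS of dimension t + 1. The same argument, with
`dualCode A` as target, bounds the dimension of (A * C)^⊥ by t; since B lies in it and has dimension
at least t, the two agree and B is MDS of dimension t. For C, take systematic rows c_i scaled to 1
at a position j₁, and put x_i = 1 / c_i(j₂). Suitable products of A and C share k + t - 1 zeros,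
hence are proportional, which forces 1 / c_i(j) to be affine in x_i
(`IsMDS.exists_eq_GRS_of_mul_embed_mem`). The generator matrix is then of Cauchy type, and such a
code is GRS (`IsMDS.exists_eq_GRS`). Once C is GRS, the same proportionality puts A and B in Cauchy
form with the same points (`isGRSWith_of_mul_embed_mem`). -/

namespace ECP

open Polynomial

/-! ### Zero counting and MDS codes -/

section Separation

variable {K : Type*} [Field K] {n : ℕ}

/-- A codeword of `X` that vanishes on at least `s` positions is zero. -/
def IsSep (X : Submodule K (Fin n → K)) (s : ℕ) : Prop :=
  ∀ x ∈ X, ∀ T : Finset (Fin n), s ≤ T.card → (∀ i ∈ T, x i = 0) → x = 0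

/-- `X` is an MDS code of dimension `s`. -/
def IsMDS (X : Submodule K (Fin n → K)) (s : ℕ) : Prop :=
  Module.finrank K X = s ∧ IsSep X s

theorem isSep_of_lt_minDist {X : Submodule K (Fin n → K)} {m : ℕ} (h : m < minDist X) :
    IsSep X (n - m) := by
  classical
  intro x hx T hT hxT
  by_contra hne
  have h1 : minDist X ≤ hammingNorm x := by
    unfold minDist
    refine Nat.sInf_le (Set.mem_insert_of_mem _ ⟨x, hx, hne, ?_⟩)
    congr!
  have h2 : hammingNorm x ≤ n - T.card := by
    have h3 : hammingNorm x ≤ (Tᶜ).card := by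
      refine Finset.card_le_card fun i hi => ?_
      rw [Finset.mem_compl]
      intro hiT
      exact (Finset.mem_filter.1 hi).2 (hxT i hiT)
    rwa [Finset.card_compl, Fintype.card_fin] at h3
  have h4 : 0 < hammingNorm x := hammingNorm_pos_iff.2 hne
  omega

/-- Restriction of the codewords of `X` to the positions in `T`. -/
def restrict (X : Submodule K (Fin n → K)) (T : Finset (Fin n)) : X →ₗ[K] (T → K) :=
  (LinearMap.funLeft K K (Subtype.val : T → Fin n)).comp X.subtype

theorem restrict_injective {X : Submodule K (Fin n → K)} {s : ℕ} (h : IsSep X s)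
    {T : Finset (Fin n)} (hT : s ≤ T.card) : Function.Injective (restrict X T) := by
  rw [← LinearMap.ker_eq_bot, LinearMap.ker_eq_bot']
  intro x hx
  exact Subtype.ext (h x x.2 T hT fun i hi => congrFun hx ⟨i, hi⟩)

theorem exists_card_eq_disjoint {T : Finset (Fin n)} {m : ℕ} (h : T.card + m ≤ n) :
    ∃ I : Finset (Fin n), I.card = m ∧ Disjoint I T := by
  obtain ⟨I, hI, hc⟩ := Finset.exists_subset_card_eq (s := Tᶜ) (n := m)
    (by rw [Finset.card_compl, Fintype.card_fin]; omega)
  exact ⟨I, hc, (Finset.subset_compl_iff_disjoint_right).1 hI⟩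

theorem IsSep.finrank_le {X : Submodule K (Fin n → K)} {s : ℕ} (h : IsSep X s) (hs : s ≤ n) :
    Module.finrank K X ≤ s := by
  obtain ⟨T, hT, -⟩ := exists_card_eq_disjoint (n := n) (T := ∅) (m := s) (by simpa using hs)
  have := LinearMap.finrank_le_finrank_of_injective (restrict_injective h hT.ge)
  simpa [hT] using this

theorem IsMDS.exists_eq {X : Submodule K (Fin n → K)} {s : ℕ} (h : IsMDS X s)
    {T : Finset (Fin n)} (hT : T.card = s) (g : Fin n → K) :
    ∃ x ∈ X, ∀ i ∈ T, x i = g i := by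
  have hs : Function.Surjective (restrict X T) :=
    (LinearMap.injective_iff_surjective_of_finrank_eq_finrank (by simp [h.1, hT])).1
      (restrict_injective h.2 hT.ge)
  obtain ⟨x, hx⟩ := hs fun i => g i
  exact ⟨x, x.2, fun i hi => congrFun hx ⟨i, hi⟩⟩

/-- In an MDS code, a set of one position less than the dimension and a further position `i`
determine a codeword with value `1` at `i`, and vanishing exactly on that set. -/
theorem IsMDS.exists_codeword {X : Submodule K (Fin n → K)} {s : ℕ} (h : IsMDS X s)
    {T : Finset (Fin n)} (hT : T.card + 1 = s) {i : Fin n} (hi : i ∉ T) :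
    ∃ x ∈ X, x i = 1 ∧ (∀ j ∈ T, x j = 0) ∧ ∀ j ∉ T, x j ≠ 0 := by
  classical
  obtain ⟨x, hx, hxe⟩ := h.exists_eq (T := insert i T)
    (by rw [Finset.card_insert_of_notMem hi, hT]) (Pi.single i 1)
  have h1 : x i = 1 := by simpa using hxe i (Finset.mem_insert_self _ _)
  have h0 : ∀ j ∈ T, x j = 0 := fun j hj => by
    rw [hxe j (Finset.mem_insert_of_mem hj), Pi.single_eq_of_ne]
    rintro rfl
    exact hi hj
  refine ⟨x, hx, h1, h0, fun j hj hxj => ?_⟩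
  have := h.2 x hx (insert j T) (by rw [Finset.card_insert_of_notMem hj, hT]) fun l hl => by
    rcases Finset.mem_insert.1 hl with rfl | hl
    · exact hxj
    · exact h0 l hl
  rw [this] at h1
  exact zero_ne_one h1

/-- At most s positions lie outside T, and words of X take arbitrary values there; pairing y with a
word that is a unit vector there reads off one entry of y. -/
theorem IsMDS.isSep_dualCode {X : Submodule K (Fin n → K)} {s : ℕ} (h : IsMDS X s)
    (hs : s ≤ n) : IsSep (dualCode X) (n - s) := by
  classical
  intro y hy T hT hyT
  have hc : (Tᶜ).card ≤ s := by rw [Finset.card_compl, Fintype.card_fin]; omega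
  obtain ⟨S, hS, hSc⟩ := Finset.exists_superset_card_eq hc (by simpa using hs)
  funext i
  by_cases hi : i ∈ T
  · exact hyT i hi
  obtain ⟨x, hx, hxe⟩ := h.exists_eq hSc (Pi.single i 1)
  have h0 : y ⬝ᵥ x = 0 := hy x hx
  have : y ⬝ᵥ x = y ⬝ᵥ Pi.single i 1 := by
    refine Finset.sum_congr rfl fun j _ => ?_
    by_cases hj : j ∈ T
    · rw [hyT j hj, zero_mul, zero_mul]
    · rw [hxe j (hS (Finset.mem_compl.2 hj))]
  rw [this, dotProduct_single, mul_one] at h0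
  exact h0

theorem le_finrank_add_finrank_dualCode (X : Submodule K (Fin n → K)) :
    n ≤ Module.finrank K X + Module.finrank K (dualCode X) := by
  let b := Module.finBasis K X
  let φ : (Fin n → K) →ₗ[K] (Fin (Module.finrank K X) → K) :=
    LinearMap.pi fun i => dotProductBilin K K (b i : Fin n → K)
  have hk : LinearMap.ker φ ≤ dualCode X := by
    intro y hy c hc
    have hX : X ≤ LinearMap.ker (dotProductBilin K K y) := by
      have hb : X = Submodule.span K (Set.range fun i => (b i : Fin n → K)) := by
        have := congrArg (Submodule.map X.subtype) b.span_eq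
        rw [Submodule.map_span, Submodule.map_top, Submodule.range_subtype, ← Set.range_comp] at this
        exact this.symm
      rw [hb, Submodule.span_le]
      rintro _ ⟨i, rfl⟩
      have hi : (b i : Fin n → K) ⬝ᵥ y = 0 := congrFun (LinearMap.mem_ker.1 hy) i
      exact (dotProduct_comm _ _).trans hi
    exact hX hc
  have h1 := LinearMap.finrank_range_add_finrank_ker φ
  have h2 := Submodule.finrank_mono hk
  have h3 := Submodule.finrank_le (LinearMap.range φ)
  simp only [Module.finrank_fin_fun] at h1 h3
  omega

/-- Two codewords vanishing on the same large set are proportional. -/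
theorem IsSep.mul_eq_mul {E : Submodule K (Fin n → K)} {m : ℕ} (hE : IsSep E (m + 1))
    {T : Finset (Fin n)} (hT : T.card = m) {x y : Fin n → K} (hx : x ∈ E) (hy : y ∈ E)
    (hxT : ∀ i ∈ T, x i = 0) (hyT : ∀ i ∈ T, y i = 0) (i j : Fin n) :
    x i * y j = x j * y i := by
  classical
  by_cases hi : i ∈ T
  · rw [hxT i hi, hyT i hi, zero_mul, mul_zero]
  -- This combination gains a zero at i, which makes m + 1 zeros.
  have := hE (x i • y - y i • x) (sub_mem (E.smul_mem _ hy) (E.smul_mem _ hx)) (insert i T)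
    (by rw [Finset.card_insert_of_notMem hi, hT]) fun l hl => by
      rcases Finset.mem_insert.1 hl with rfl | hl
      · simp [mul_comm]
      · simp [hxT l hl, hyT l hl]
  have := congrFun this j
  simp only [Pi.sub_apply, Pi.smul_apply, smul_eq_mul, Pi.zero_apply] at this
  linear_combination this

end Separation

/-! ### Brackets on the projective line and GRS codes -/

section ReedSolomon

variable {K : Type*} [Field K] {n : ℕ}

/-- The polynomial of degree at most one that vanishes at the given point of the projective
line. -/
noncomputable def lineForm : OnePoint K → K[X]
  | none => 1
  | some x => X - C x

/-- A bracket on the projective line: the value at `q` of the linear form vanishing at `p`. -/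
noncomputable def wedge (p q : OnePoint K) : K := evalAt 2 q (lineForm p)

theorem natDegree_lineForm_le (p : OnePoint K) : (lineForm p).natDegree ≤ 1 := by
  rcases p with _ | x
  · simp [lineForm]
  · exact natDegree_X_sub_C_le x

theorem wedge_coe_coe (x y : K) : wedge (x : OnePoint K) (y : OnePoint K) = y - x := by
  change eval y (X - C x) = y - x
  simp

theorem wedge_coe_infty (x : K) : wedge (x : OnePoint K) OnePoint.infty = 1 := by
  change coeff (X - C x) 1 = 1
  simp

theorem wedge_infty_coe (x : K) : wedge OnePoint.infty (x : OnePoint K) = 1 := by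
  change eval x 1 = 1
  simp

theorem wedge_infty_infty : wedge (OnePoint.infty : OnePoint K) OnePoint.infty = 0 := by
  change coeff (1 : K[X]) 1 = 0
  simp [coeff_one]

theorem wedge_eq_zero_iff {p q : OnePoint K} : wedge p q = 0 ↔ p = q := by
  induction p using OnePoint.rec with
  | infty =>
    induction q using OnePoint.rec with
    | infty => simp [wedge_infty_infty]
    | coe y => simp [wedge_infty_coe]
  | coe x =>
    induction q using OnePoint.rec with
    | infty => simp [wedge_coe_infty]
    | coe y => rw [wedge_coe_coe, sub_eq_zero, OnePoint.coe_eq_coe, eq_comm]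

theorem wedge_map {L : Type*} [Field L] [Algebra K L] (p q : OnePoint K) :
    wedge (p.map (algebraMap K L)) (q.map (algebraMap K L)) = algebraMap K L (wedge p q) := by
  induction p using OnePoint.rec with
  | infty =>
    induction q using OnePoint.rec with
    | infty => simp [wedge_infty_infty]
    | coe y => simp [wedge_infty_coe]
  | coe x =>
    induction q using OnePoint.rec with
    | infty => simp [wedge_coe_infty]
    | coe y => simp [wedge_coe_coe]

theorem natDegree_prod_lineForm_le (a : Fin n → OnePoint K) (T : Finset (Fin n)) :
    (∏ l ∈ T, lineForm (a l)).natDegree ≤ T.card :=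
  (natDegree_prod_le _ _).trans <|
    (Finset.sum_le_card_nsmul T _ 1 fun l _ => natDegree_lineForm_le (a l)).trans (by simp)

/-- At infinity this is multiplicativity of the formal top coefficient: each factor has degree at
most 1, so the coefficients of X multiply to that of X^|T|. -/
theorem evalAt_prod_lineForm (a : Fin n → OnePoint K) (T : Finset (Fin n)) (q : OnePoint K) :
    evalAt (T.card + 1) q (∏ l ∈ T, lineForm (a l)) = ∏ l ∈ T, wedge (a l) q := by
  rcases q with _ | y
  · have := coeff_prod_of_natDegree_le (s := T) (f := fun l => lineForm (a l)) 1
      fun l _ => natDegree_lineForm_le (a l)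
    rw [mul_one] at this
    exact this
  · exact eval_prod T (fun l => lineForm (a l)) y

/-- Supplies GRS codewords with k - 1 prescribed zeros, treating the point at infinity like any
other. -/
theorem prod_wedge_mem_GRS (a : Fin n → OnePoint K) (b : Fin n → K) {k : ℕ} {T : Finset (Fin n)}
    (hT : T.card + 1 = k) : (fun j => b j * ∏ l ∈ T, wedge (a l) (a j)) ∈ GRS k a b := by
  subst hT
  refine ⟨∏ l ∈ T, lineForm (a l), ?_, ?_⟩
  · rw [SetLike.mem_coe, mem_degreeLT]
    exact lt_of_le_of_lt (natDegree_le_iff_degree_le.1 (natDegree_prod_lineForm_le a T))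
      (by exact_mod_cast Nat.lt_succ_self _)
  · funext j
    simp [evalMap, evalAt_prod_lineForm]

theorem finrank_GRS_le (k : ℕ) (a : Fin n → OnePoint K) (b : Fin n → K) :
    Module.finrank K (GRS k a b) ≤ k := by
  have e := degreeLTEquiv K k
  have : Module.Finite K (degreeLT K k) := Module.Finite.equiv e.symm
  refine (Submodule.finrank_map_le _ _).trans ?_
  rw [e.finrank_eq, Module.finrank_fin_fun]

/-- An MDS code whose systematic generator matrix is a generalized Cauchy matrix is a
generalized Reed-Solomon code. -/
theorem IsMDS.exists_eq_GRS {X : Submodule K (Fin n → K)} {s : ℕ} (hX : IsMDS X s)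
    {S : Finset (Fin n)} (hS : S.card = s) {a : Fin n → OnePoint K} (ha : Function.Injective a)
    {c : Fin n → Fin n → K} (hcX : ∀ i ∈ S, c i ∈ X) (hc1 : ∀ i ∈ S, c i i ≠ 0)
    (hc0 : ∀ i ∈ S, ∀ l ∈ S, l ≠ i → c i l = 0) {α w : Fin n → K} (hα : ∀ i ∈ S, α i ≠ 0)
    (hw : ∀ j ∉ S, w j ≠ 0)
    (h : ∀ i ∈ S, ∀ j ∉ S, c i j * wedge (a i) (a j) = α i * w j) :
    ∃ b : Fin n → K, (∀ i, b i ≠ 0) ∧ X = GRS s a b := by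
  classical
  have hne : ∀ {i j}, i ≠ j → wedge (a i) (a j) ≠ 0 := fun hij h0 =>
    hij (ha (wedge_eq_zero_iff.1 h0))
  have hP : ∀ j, ∏ l ∈ S.erase j, wedge (a l) (a j) ≠ 0 := fun j =>
    Finset.prod_ne_zero_iff.2 fun l hl => hne (Finset.ne_of_mem_erase hl)
  -- Chosen so that c i j = α i * b j * ∏ [a l, a j] over l in S \ {i}: the rows become scaled
  -- Lagrange basis words. For j outside S the erasure is void.
  let b : Fin n → K := fun j =>
    (if j ∈ S then (α j)⁻¹ * c j j else w j) / ∏ l ∈ S.erase j, wedge (a l) (a j)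
  have hb : ∀ j, b j ≠ 0 := fun j => by
    refine div_ne_zero ?_ (hP j)
    split_ifs with hj
    · exact mul_ne_zero (inv_ne_zero (hα j hj)) (hc1 j hj)
    · exact hw j hj
  refine ⟨b, hb, ?_⟩
  have hcG : ∀ i ∈ S, c i ∈ GRS s a b := by
    intro i hi
    have hm := (GRS s a b).smul_mem (α i) (prod_wedge_mem_GRS a b (k := s) (T := S.erase i)
      (by rw [Finset.card_erase_add_one hi, hS]))
    convert hm using 1
    funext j
    simp only [Pi.smul_apply, smul_eq_mul]
    by_cases hj : j ∈ S
    · by_cases hij : j = i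
      · subst hij
        have := hα j hj
        have := hP j
        simp only [b, if_pos hj]
        field_simp
      · rw [hc0 i hi j hj hij, Finset.prod_eq_zero (Finset.mem_erase.2 ⟨hij, hj⟩)
          (wedge_eq_zero_iff.2 rfl), mul_zero, mul_zero]
    · have h1 := h i hi j hj
      have h2 := Finset.mul_prod_erase S (fun l => wedge (a l) (a j)) hi
      have h3 : i ≠ j := fun e => hj (e ▸ hi)
      have h4 := hne h3
      have h5 := hP j
      simp only [b, if_neg hj]
      rw [Finset.erase_eq_of_notMem hj] at h5 ⊢
      rw [← h2] at h5 ⊢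
      have h6 := right_ne_zero_of_mul h5
      field_simp
      linear_combination h1
  refine Submodule.eq_of_le_of_finrank_le (fun x hx => ?_) ((finrank_GRS_le s a b).trans hX.1.ge)
  have hsum : ∑ i ∈ S, (x i / c i i) • c i ∈ X :=
    sum_mem fun i hi => X.smul_mem _ (hcX i hi)
  have hxe : x = ∑ i ∈ S, (x i / c i i) • c i := by
    refine sub_eq_zero.1 (hX.2 _ (sub_mem hx hsum) S hS.ge fun j hj => ?_)
    rw [Pi.sub_apply, Finset.sum_apply, Finset.sum_eq_single j]
    · simp [hc1 j hj]
    · intro i hi hij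
      simp [hc0 i hi j hj hij.symm]
    · exact fun hj' => absurd hj hj'
  rw [hxe]
  exact sum_mem fun i hi => Submodule.smul_mem _ _ (hcG i hi)

end ReedSolomon

/-! ### Products with an MDS code -/

section Pairs

variable {F K : Type*} [Field F] [Field K] [Algebra F K] {n : ℕ}

/-- The coordinatewise embedding of `F ^ n` into `K ^ n`. -/
def embed (F K : Type*) [Field F] [Field K] [Algebra F K] {n : ℕ} (c : Fin n → F) : Fin n → K :=
  fun i => algebraMap F K (c i)

theorem embed_apply (c : Fin n → F) (i : Fin n) : embed F K c i = algebraMap F K (c i) := rfl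

theorem embed_ne_zero {c : Fin n → F} {i : Fin n} (h : c i ≠ 0) : embed F K c i ≠ 0 :=
  (_root_.map_ne_zero (algebraMap F K)).2 h

/-- If the products of the words of `X` and of the MDS code `C` lie in a code with good
separation, then so does `X`. -/
theorem isSep_of_mul_embed_mem {C : Submodule F (Fin n → F)} {k m s : ℕ} (hC : IsMDS C k)
    (hk : 1 ≤ k) {X E : Submodule K (Fin n → K)} (hE : IsSep E m)
    (h : ∀ x ∈ X, ∀ c ∈ C, x * embed F K c ∈ E) (hm : m + 1 ≤ s + k) (hs : s + k ≤ n) :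
    IsSep X s := by
  classical
  intro x hx T hT hxT
  obtain ⟨T', hT', hc⟩ := Finset.exists_subset_card_eq hT
  funext i
  by_contra hi
  change x i ≠ 0 at hi
  have hiT : i ∉ T' := fun h => hi (hxT i (hT' h))
  -- A word of C vanishing on R but not at i gives a product with at least m zeros that is nonzero
  -- at i.
  obtain ⟨R, hR, hd⟩ := exists_card_eq_disjoint (T := insert i T') (m := k - 1)
    (by rw [Finset.card_insert_of_notMem hiT]; omega)
  rw [Finset.disjoint_insert_right] at hd
  obtain ⟨c, hcC, hci, hc0, -⟩ := hC.exists_codeword (T := R) (by omega) hd.1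
  have h0 := hE _ (h x hx c hcC) (R ∪ T')
    (by rw [Finset.card_union_of_disjoint hd.2]; omega) fun l hl => by
      rw [Pi.mul_apply, embed_apply]
      rcases Finset.mem_union.1 hl with hl | hl
      · rw [hc0 l hl, map_zero, mul_zero]
      · rw [hxT l (hT' hl), zero_mul]
  have := congrFun h0 i
  rw [Pi.mul_apply, embed_apply, hci, map_one, mul_one] at this
  exact hi this

theorem injective_map_algebraMap {a : Fin n → OnePoint F} (ha : Function.Injective a) :
    Function.Injective fun i => (a i).map (algebraMap F K) :=
  (Option.map_injective (algebraMap F K).injective).comp ha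

/-- If the products of the words of the MDS code `X` and of a generalized Reed-Solomon code lie in
a code with good separation, then `X` is a generalized Reed-Solomon code with the same evaluation
points. -/
theorem isGRSWith_of_mul_embed_mem {a : Fin n → OnePoint F} (ha : Function.Injective a)
    {b : Fin n → F} (hb : ∀ i, b i ≠ 0) {k s : ℕ} (hk : 2 ≤ k) (hs : 1 ≤ s) (hn : s + k ≤ n)
    {X E : Submodule K (Fin n → K)} (hX : IsMDS X s) (hE : IsSep E (s + k - 1))
    (h : ∀ x ∈ X, ∀ c ∈ GRS k a b, x * embed F K c ∈ E) :
    IsGRSWith X fun i => (a i).map (algebraMap F K) := by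
  classical
  set p : Fin n → OnePoint K := fun i => (a i).map (algebraMap F K) with hp
  have hpi : Function.Injective p := injective_map_algebraMap ha
  have hne : ∀ {i j}, i ≠ j → wedge (p i) (p j) ≠ 0 := fun hij h0 =>
    hij (hpi (wedge_eq_zero_iff.1 h0))
  refine ⟨hpi, s, by omega, ?_⟩
  obtain ⟨T, hT, -⟩ := exists_card_eq_disjoint (n := n) (T := ∅) (m := s)
    (by rw [Finset.card_empty]; omega)
  have hex : ∀ i, ∃ x : Fin n → K, i ∈ T →
      x ∈ X ∧ x i = 1 ∧ (∀ j ∈ T.erase i, x j = 0) ∧ ∀ j ∉ T.erase i, x j ≠ 0 := by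
    intro i
    by_cases hi : i ∈ T
    · obtain ⟨x, hx⟩ := hX.exists_codeword (T := T.erase i)
        (by rw [Finset.card_erase_add_one hi, hT]) (Finset.notMem_erase i T)
      exact ⟨x, fun _ => hx⟩
    · exact ⟨0, fun h => absurd h hi⟩
  choose c hc using hex
  -- The Cauchy form of X amounts to this matrix having rank one on T × Tᶜ, which is `key`.
  set m : Fin n → Fin n → K := fun i j => c i j * wedge (p i) (p j) with hm
  have hm0 : ∀ i ∈ T, ∀ j ∉ T, m i j ≠ 0 := fun i hi j hj =>
    mul_ne_zero ((hc i hi).2.2.2 j fun h => hj (Finset.mem_of_mem_erase h))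
      (hne fun e => hj (e ▸ hi))
  have key : ∀ i ∈ T, ∀ i' ∈ T, ∀ j ∉ T, ∀ j' ∉ T, m i j * m i' j' = m i j' * m i' j := by
    intro i hi i' hi' j hj j' hj'
    obtain ⟨I, hI, hd⟩ := exists_card_eq_disjoint (T := insert j (insert j' T)) (m := k - 2) (by
      have := Finset.card_insert_le j (insert j' T)
      have := Finset.card_insert_le j' T
      omega)
    rw [Finset.disjoint_insert_right, Finset.disjoint_insert_right] at hd
    have hiI : ∀ {l}, l ∈ T → l ∉ I := fun hl hlI => Finset.disjoint_left.1 hd.2.2 hlI hl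
    -- The zero of g l at l cancels the one nonzero entry of c l on T, so all products vanish on T ∪
    -- I and are proportional. The factor coming from I does not depend on l and drops out.
    let g : Fin n → Fin n → F := fun l r => b r * ∏ u ∈ insert l I, wedge (a u) (a r)
    have hg : ∀ l ∈ T, g l ∈ GRS k a b := fun l hl =>
      prod_wedge_mem_GRS a b (by rw [Finset.card_insert_of_notMem (hiI hl)]; omega)
    have hz : ∀ l ∈ T, ∀ r ∈ T ∪ I, (c l * embed F K (g l)) r = 0 := by
      intro l hl r hr
      rw [Pi.mul_apply]
      by_cases hrI : r ∈ insert l I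
      · have : g l r = 0 := mul_eq_zero_of_right _ (Finset.prod_eq_zero hrI
          (wedge_eq_zero_iff.2 rfl))
        rw [embed_apply, this, map_zero, mul_zero]
      · rw [Finset.mem_insert, not_or] at hrI
        rw [(hc l hl).2.2.1 r (Finset.mem_erase.2
          ⟨hrI.1, (Finset.mem_union.1 hr).resolve_right hrI.2⟩), zero_mul]
    have hE' : IsSep E ((T ∪ I).card + 1) := by
      rw [Finset.card_union_of_disjoint hd.2.2.symm, hT, hI]
      convert hE using 1
      omega
    have hprod := hE'.mul_eq_mul rfl (h _ (hc i hi).1 _ (hg i hi)) (h _ (hc i' hi').1 _ (hg i' hi'))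
      (hz i hi) (hz i' hi') j j'
    have hv : ∀ l ∈ T, ∀ r, (c l * embed F K (g l)) r =
        m l r * algebraMap F K (b r * ∏ u ∈ I, wedge (a u) (a r)) := by
      intro l hl r
      simp only [Pi.mul_apply, embed_apply, hm, hp, wedge_map, g,
        Finset.prod_insert (hiI hl), map_mul]
      ring
    have hu : ∀ r ∉ I, algebraMap F K (b r * ∏ u ∈ I, wedge (a u) (a r)) ≠ 0 := by
      intro r hr
      refine (_root_.map_ne_zero _).2 (mul_ne_zero (hb r) (Finset.prod_ne_zero_iff.2 fun u hu h0 => ?_))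
      exact hr (ha (wedge_eq_zero_iff.1 h0) ▸ hu)
    rw [hv i hi, hv i hi, hv i' hi', hv i' hi'] at hprod
    have hj0 := hu j fun h => hd.1 h
    have hj0' := hu j' fun h => hd.2.1 h
    refine mul_right_cancel₀ (mul_ne_zero hj0 hj0') ?_
    linear_combination hprod
  obtain ⟨i₀, hi₀⟩ : T.Nonempty := Finset.card_pos.1 (by omega)
  obtain ⟨J, hJ, hJT⟩ := exists_card_eq_disjoint (n := n) (T := T) (m := 1) (by omega)
  obtain ⟨j₀, rfl⟩ := Finset.card_eq_one.1 hJ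
  have hj₀ : j₀ ∉ T := Finset.disjoint_singleton_left.1 hJT
  -- A rank-one matrix factors through its column j₀ and its row i₀.
  refine hX.exists_eq_GRS hT hpi (c := c) (α := fun i => m i j₀)
    (w := fun j => m i₀ j / m i₀ j₀) (fun i hi => (hc i hi).1) (fun i hi => ?_)
    (fun i hi l hl hli => (hc i hi).2.2.1 l (Finset.mem_erase.2 ⟨hli, hl⟩))
    (fun i hi => hm0 i hi j₀ hj₀)
    (fun j hj => div_ne_zero (hm0 i₀ hi₀ j hj) (hm0 i₀ hi₀ j₀ hj₀)) fun i hi j hj => ?_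
  · rw [(hc i hi).2.1]
    exact one_ne_zero
  · have h1 := key i hi i₀ hi₀ j hj j₀ hj₀
    have h2 := hm0 i₀ hi₀ j₀ hj₀
    change m i j = _
    field_simp
    exact h1

/-- A `k`-dimensional MDS code is a generalized Reed-Solomon code if the entrywise inverse of its
normalized systematic generator matrix has rank two. -/
theorem IsMDS.exists_eq_GRS_of_affine {C : Submodule F (Fin n → F)} {k : ℕ} (hC : IsMDS C k)
    (hk : 2 ≤ k) {S : Finset (Fin n)} (hS : S.card = k) {c : Fin n → Fin n → F}
    (hcC : ∀ i ∈ S, c i ∈ C) (hc0 : ∀ i ∈ S, ∀ j ∈ S.erase i, c i j = 0)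
    (hc1 : ∀ i ∈ S, ∀ j ∉ S.erase i, c i j ≠ 0) {x r s : Fin n → F}
    (hx : Set.InjOn x S) (h : ∀ i ∈ S, ∀ j ∉ S, c i j * (r j + s j * x i) = 1) :
    ∃ a : Fin n → OnePoint F, Function.Injective a ∧
      ∃ b : Fin n → F, (∀ i, b i ≠ 0) ∧ C = GRS k a b := by
  classical
  -- Outside S the point is the zero of r j + s j * X, or infinity when this is constant.
  let a : Fin n → OnePoint F := fun j =>
    if j ∈ S then (x j : F) else if s j = 0 then OnePoint.infty else ((-(r j / s j) : F) : OnePoint F)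
  let w : Fin n → F := fun j => if s j = 0 then (r j)⁻¹ else -(s j)⁻¹
  obtain ⟨i₁, hi₁, i₂, hi₂, hi⟩ := Finset.one_lt_card.1 (by omega : 1 < S.card)
  have hcn : ∀ i ∈ S, ∀ j ∉ S, c i j ≠ 0 := fun i hi j hj =>
    hc1 i hi j fun h => hj (Finset.mem_of_mem_erase h)
  have hw : ∀ j ∉ S, w j ≠ 0 := by
    intro j hj
    have h1 := h i₁ hi₁ j hj
    simp only [w]
    split_ifs with h0
    · refine inv_ne_zero fun hr => ?_
      rw [h0, hr] at h1
      simp at h1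
    · exact neg_ne_zero.2 (inv_ne_zero h0)
  have hcw : ∀ i ∈ S, ∀ j ∉ S, c i j * wedge (a i) (a j) = w j := by
    intro i hi j hj
    have h1 := h i hi j hj
    simp only [a, w, if_pos hi, if_neg hj]
    split_ifs with h0
    · rw [wedge_coe_infty]
      rw [h0, zero_mul, add_zero] at h1
      rw [mul_one]
      exact eq_inv_of_mul_eq_one_left h1
    · rw [wedge_coe_coe]
      field_simp
      linear_combination -h1
  have hne : ∀ i ∈ S, ∀ j ∉ S, a i ≠ a j := fun i hi j hj e => by
    have := hcw i hi j hj
    rw [wedge_eq_zero_iff.2 e, mul_zero] at this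
    exact hw j hj this.symm
  have hinj : Function.Injective a := by
    intro j j' e
    by_cases hj : j ∈ S <;> by_cases hj' : j' ∈ S
    · simp only [a, if_pos hj, if_pos hj'] at e
      exact hx hj hj' (OnePoint.coe_injective e)
    · exact absurd e (hne j hj j' hj')
    · exact absurd e.symm (hne j' hj' j hj)
    · by_contra hjj
      have hprop : ∀ i ∈ S, c i j * w j' = c i j' * w j := fun i hi => by
        rw [← hcw i hi j hj, ← hcw i hi j' hj', e]
        ring
      have hi12 : i₂ ∈ S.erase i₁ := Finset.mem_erase.2 ⟨hi.symm, hi₂⟩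
      -- Equal points at j and j' make the two rows proportional there, so y has k zeros (j, j' and
      -- k - 2 in S) without being 0.
      set y : Fin n → F := c i₂ j • c i₁ - c i₁ j • c i₂ with hy
      have hyj : y j = 0 := by simp [hy, mul_comm]
      have hyj' : y j' = 0 := by
        have h1 := hprop i₁ hi₁
        have h2 := hprop i₂ hi₂
        refine mul_right_cancel₀ (mul_ne_zero (hw j hj) (hw j' hj')) ?_
        simp only [hy, Pi.sub_apply, Pi.smul_apply, smul_eq_mul]
        linear_combination c i₁ j * w j' * h2 - c i₂ j * w j' * h1
      have hyS : ∀ l ∈ (S.erase i₁).erase i₂, y l = 0 := by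
        intro l hl
        have hl2 := Finset.mem_of_mem_erase hl
        have hl1 : l ∈ S.erase i₂ := Finset.mem_erase.2
          ⟨Finset.ne_of_mem_erase hl, Finset.mem_of_mem_erase hl2⟩
        simp [hy, hc0 i₁ hi₁ l hl2, hc0 i₂ hi₂ l hl1]
      have hjn : j ∉ (S.erase i₁).erase i₂ := fun h =>
        hj (Finset.mem_of_mem_erase (Finset.mem_of_mem_erase h))
      have hjn' : j' ∉ insert j ((S.erase i₁).erase i₂) := fun h => by
        rcases Finset.mem_insert.1 h with h | h
        · exact hjj h.symm
        · exact hj' (Finset.mem_of_mem_erase (Finset.mem_of_mem_erase h))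
      have h0 := hC.2 y (sub_mem (C.smul_mem _ (hcC i₁ hi₁)) (C.smul_mem _ (hcC i₂ hi₂)))
        (insert j' (insert j ((S.erase i₁).erase i₂))) (by
          rw [Finset.card_insert_of_notMem hjn', Finset.card_insert_of_notMem hjn,
            Finset.card_erase_of_mem hi12, Finset.card_erase_of_mem hi₁]
          omega) fun l hl => by
            rcases Finset.mem_insert.1 hl with rfl | hl
            · exact hyj'
            rcases Finset.mem_insert.1 hl with rfl | hl
            · exact hyj
            · exact hyS l hl
      have h1 := congrFun h0 i₁
      simp only [hy, Pi.sub_apply, Pi.smul_apply, smul_eq_mul, Pi.zero_apply,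
        hc0 i₂ hi₂ i₁ (Finset.mem_erase.2 ⟨hi, hi₁⟩), mul_zero, sub_zero] at h1
      exact mul_ne_zero (hcn i₂ hi₂ j hj) (hc1 i₁ hi₁ i₁ (Finset.notMem_erase _ _)) h1
  refine ⟨a, hinj, hC.exists_eq_GRS hS hinj (c := c) (α := fun _ => 1) (w := w) hcC
    (fun i hi => hc1 i hi i (Finset.notMem_erase _ _))
    (fun i hi l hl hli => hc0 i hi l (Finset.mem_erase.2 ⟨hli, hl⟩)) (fun _ _ => one_ne_zero) hw
    fun i hi j hj => ?_⟩
  rw [one_mul, hcw i hi j hj]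

/-- An MDS code with an error-correcting pair of MDS type is a generalized Reed-Solomon code. -/
theorem IsMDS.exists_eq_GRS_of_mul_embed_mem {C : Submodule F (Fin n → F)} {k t : ℕ}
    (hC : IsMDS C k) (hk : 2 ≤ k) (ht : 1 ≤ t) (hn : n = k + 2 * t)
    {A E : Submodule K (Fin n → K)} (hA : IsMDS A (t + 1)) (hE : IsSep E (k + t))
    (h : ∀ x ∈ A, ∀ c ∈ C, x * embed F K c ∈ E) :
    ∃ a : Fin n → OnePoint F, Function.Injective a ∧
      ∃ b : Fin n → F, (∀ i, b i ≠ 0) ∧ C = GRS k a b := by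
  classical
  obtain ⟨S, hS, -⟩ := exists_card_eq_disjoint (n := n) (T := ∅) (m := k)
    (by rw [Finset.card_empty]; omega)
  obtain ⟨J, hJ, hJS⟩ := exists_card_eq_disjoint (n := n) (T := S) (m := 2) (by omega)
  obtain ⟨j₁, j₂, hj, rfl⟩ := Finset.card_eq_two.1 hJ
  rw [Finset.disjoint_insert_left, Finset.disjoint_singleton_left] at hJS
  obtain ⟨hj₁, hj₂⟩ := hJS
  have hex : ∀ i, ∃ c : Fin n → F, i ∈ S → c ∈ C ∧ c j₁ = 1 ∧
      (∀ j ∈ S.erase i, c j = 0) ∧ ∀ j ∉ S.erase i, c j ≠ 0 := by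
    intro i
    by_cases hi : i ∈ S
    · obtain ⟨c, hc⟩ := hC.exists_codeword (T := S.erase i) (i := j₁)
        (by rw [Finset.card_erase_add_one hi, hS]) fun h => hj₁ (Finset.mem_of_mem_erase h)
      exact ⟨c, fun _ => hc⟩
    · exact ⟨0, fun h => absurd h hi⟩
  choose c hc using hex
  have hcn : ∀ i ∈ S, ∀ j ∉ S, c i j ≠ 0 := fun i hi j hj =>
    (hc i hi).2.2.2 j fun h => hj (Finset.mem_of_mem_erase h)
  let x : Fin n → F := fun i => (c i j₂)⁻¹
  -- If x i = x i', the word c i - c i' vanishes at j₁, j₂ and k - 2 positions of S.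
  have hx : Set.InjOn x S := by
    intro i hi i' hi' e
    by_contra hii
    have e' : c i j₂ = c i' j₂ := inv_injective e
    have hi1 : i' ∈ S.erase i := Finset.mem_erase.2 ⟨fun e => hii e.symm, hi'⟩
    have hn1 : j₁ ∉ (S.erase i).erase i' := fun h =>
      hj₁ (Finset.mem_of_mem_erase (Finset.mem_of_mem_erase h))
    have hn2 : j₂ ∉ insert j₁ ((S.erase i).erase i') := fun h => by
      rcases Finset.mem_insert.1 h with h | h
      · exact hj h.symm
      · exact hj₂ (Finset.mem_of_mem_erase (Finset.mem_of_mem_erase h))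
    have h0 := hC.2 (c i - c i') (sub_mem (hc i hi).1 (hc i' hi').1)
      (insert j₂ (insert j₁ ((S.erase i).erase i'))) (by
        rw [Finset.card_insert_of_notMem hn2, Finset.card_insert_of_notMem hn1,
          Finset.card_erase_of_mem hi1, Finset.card_erase_of_mem hi]
        omega) fun l hl => by
          rw [Pi.sub_apply]
          rcases Finset.mem_insert.1 hl with rfl | hl
          · rw [e', sub_self]
          rcases Finset.mem_insert.1 hl with rfl | hl
          · rw [(hc i hi).2.1, (hc i' hi').2.1, sub_self]
          · have hl2 := Finset.mem_of_mem_erase hl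
            rw [(hc i hi).2.2.1 l hl2, (hc i' hi').2.2.1 l (Finset.mem_erase.2
              ⟨Finset.ne_of_mem_erase hl, Finset.mem_of_mem_erase hl2⟩), sub_self]
    have h1 := congrFun h0 i
    rw [Pi.sub_apply, (hc i' hi').2.2.1 i (Finset.mem_erase.2 ⟨hii, hi⟩), sub_zero] at h1
    exact (hc i hi).2.2.2 i (Finset.notMem_erase _ _) h1
  obtain ⟨i₁, hi₁, i₂, hi₂, hi⟩ := Finset.one_lt_card.1 (by omega : 1 < S.card)
  have hK : ∀ j ∉ S, ∃ r s : K, ∀ i ∈ S,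
      algebraMap F K (c i j) * (r + s * algebraMap F K (x i)) = 1 := by
    intro j hjS
    by_cases hjj₁ : j = j₁
    · subst hjj₁
      exact ⟨1, 0, fun i hi => by simp [(hc i hi).2.1]⟩
    by_cases hjj₂ : j = j₂
    · subst hjj₂
      exact ⟨0, 1, fun i hi => by simp [x, hcn i hi j hjS]⟩
    have hex3 : ∃ I : Finset (Fin n), I.card = t - 1 ∧ Disjoint I (insert j {j₁, j₂} ∪ S) := by
      have h1 : Disjoint (insert j {j₁, j₂}) S := by
        simp [Finset.disjoint_insert_left, hjS, hj₁, hj₂]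
      have h2 : (insert j ({j₁, j₂} : Finset (Fin n))).card = 3 := by
        rw [Finset.card_insert_of_notMem (by simp [hjj₁, hjj₂]), hJ]
      have h3 := Finset.card_union_of_disjoint h1
      have h4 := Finset.card_le_univ (insert j {j₁, j₂} ∪ S)
      rw [Fintype.card_fin] at h4
      exact exists_card_eq_disjoint (by omega)
    obtain ⟨I, hI, hd⟩ := hex3
    rw [Finset.disjoint_union_right, Finset.disjoint_insert_right, Finset.disjoint_insert_right,
      Finset.disjoint_singleton_right] at hd
    obtain ⟨⟨hjI, hj₁I, hj₂I⟩, hIS⟩ := hd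
    have hiI : ∀ {l}, l ∈ S → l ∉ I := fun hl hlI => Finset.disjoint_left.1 hIS hlI hl
    obtain ⟨u, huA, hu2, hu0, hun⟩ := hA.exists_codeword (T := insert j₁ I) (i := j₂)
      (by rw [Finset.card_insert_of_notMem hj₁I]; omega) (by simp [hj.symm, hj₂I])
    obtain ⟨v, hvA, hv1, hv0, -⟩ := hA.exists_codeword (T := insert j₂ I) (i := j₁)
      (by rw [Finset.card_insert_of_notMem hj₂I]; omega) (by simp [hj, hj₁I])
    have hu1 : u j₁ = 0 := hu0 j₁ (Finset.mem_insert_self _ _)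
    have hv2 : v j₂ = 0 := hv0 j₂ (Finset.mem_insert_self _ _)
    have huS : ∀ i ∈ S, u i ≠ 0 := fun i hi => hun i fun h => by
      rcases Finset.mem_insert.1 h with rfl | h
      · exact hj₁ hi
      · exact hiI hi h
    -- The first factor kills position i and all of I, the second the rest of S: k + t - 1 common
    -- zeros, so the words e i are mutually proportional.
    let e : Fin n → Fin n → K := fun i => (v i • u - u i • v) * embed F K (c i)
    have heE : ∀ i ∈ S, e i ∈ E := fun i hi =>
      h _ (sub_mem (A.smul_mem _ huA) (A.smul_mem _ hvA)) _ (hc i hi).1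
    have he : ∀ i l, e i l = (v i * u l - u i * v l) * algebraMap F K (c i l) := fun i l => rfl
    have he0 : ∀ i ∈ S, ∀ l ∈ I ∪ S, e i l = 0 := by
      intro i hi l hl
      rw [he]
      rcases Finset.mem_union.1 hl with hl | hl
      · rw [hu0 l (Finset.mem_insert_of_mem hl), hv0 l (Finset.mem_insert_of_mem hl)]
        simp
      · by_cases hli : l = i
        · subst hli
          rw [mul_comm (v l), sub_self, zero_mul]
        · rw [(hc i hi).2.2.1 l (Finset.mem_erase.2 ⟨hli, hl⟩), map_zero, mul_zero]
    have hcard : (I ∪ S).card + 1 = k + t := by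
      rw [Finset.card_union_of_disjoint hIS]
      omega
    rw [← hcard] at hE
    have he1 : ∀ i ∈ S, e i j₁ = -u i := fun i hi => by
      rw [he, hu1, hv1, (hc i hi).2.1]
      simp
    have he2 : ∀ i ∈ S, e i j₂ = v i * algebraMap F K (c i j₂) := fun i hi => by
      rw [he, hu2, hv2]
      simp
    have hej : e i₁ j ≠ 0 := fun h0 => by
      have h1 := hE _ (heE i₁ hi₁) (insert j (I ∪ S))
        (by rw [Finset.card_insert_of_notMem (by simp [hjI, hjS])]) fun l hl => by
          rcases Finset.mem_insert.1 hl with rfl | hl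
          · exact h0
          · exact he0 i₁ hi₁ l hl
      have h2 := congrFun h1 j₁
      rw [he1 i₁ hi₁] at h2
      exact huS i₁ hi₁ (neg_eq_zero.1 h2)
    -- Comparing e i with e i₁ at j₁ and j₂ gives v i / u i = e i₁ j₂ * x i / u i₁; comparing at j₁
    -- and j gives 1 / c i j as an affine function of v i / u i.
    refine ⟨-(u i₁ * v j) / e i₁ j, e i₁ j₂ * u j / e i₁ j, fun i hi => ?_⟩
    have p1 := hE.mul_eq_mul rfl (heE i hi) (heE i₁ hi₁) (he0 i hi) (he0 i₁ hi₁) j₁ j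
    have p2 := hE.mul_eq_mul rfl (heE i hi) (heE i₁ hi₁) (he0 i hi) (he0 i₁ hi₁) j₁ j₂
    rw [he1 i hi, he1 i₁ hi₁] at p1 p2
    rw [he2 i hi] at p2
    rw [he i j] at p1
    have h1 := huS i hi
    have h2 : algebraMap F K (c i j₂) ≠ 0 := (_root_.map_ne_zero _).2 (hcn i hi j₂ hj₂)
    simp only [x, map_inv₀]
    field_simp
    refine mul_left_cancel₀ h1 ?_
    linear_combination algebraMap F K (c i j₂) * p1 - algebraMap F K (c i j) * u j * p2
  have hF : ∀ j, ∃ r s : F, j ∉ S → ∀ i ∈ S, c i j * (r + s * x i) = 1 := by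
    intro j
    by_cases hjS : j ∈ S
    · exact ⟨0, 0, fun h => absurd hjS h⟩
    obtain ⟨r, s, hrs⟩ := hK j hjS
    have hxx : x i₂ - x i₁ ≠ 0 := sub_ne_zero.2 fun e => hi (hx hi₂ hi₁ e).symm
    have hval : ∀ i ∈ S, algebraMap F K (c i j)⁻¹ = r + s * algebraMap F K (x i) := fun i hi => by
      rw [map_inv₀]
      exact (eq_inv_of_mul_eq_one_right (hrs i hi)).symm
    -- Descent to F: an affine function is determined by its values at two points, here all in F.
    have hs : algebraMap F K (((c i₂ j)⁻¹ - (c i₁ j)⁻¹) / (x i₂ - x i₁)) = s := by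
      have hxx' := (_root_.map_ne_zero (algebraMap F K)).2 hxx
      rw [map_div₀, div_eq_iff hxx', map_sub, map_sub, hval i₂ hi₂, hval i₁ hi₁]
      ring
    refine ⟨(c i₁ j)⁻¹ - ((c i₂ j)⁻¹ - (c i₁ j)⁻¹) / (x i₂ - x i₁) * x i₁,
      ((c i₂ j)⁻¹ - (c i₁ j)⁻¹) / (x i₂ - x i₁), fun _ i hi => (algebraMap F K).injective ?_⟩
    rw [map_mul, map_add, map_sub, map_mul, map_mul, hs, hval i₁ hi₁, map_one]
    linear_combination hrs i hi
  choose r s hrs using hF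
  exact hC.exists_eq_GRS_of_affine hk hS (fun i hi => (hc i hi).1) (fun i hi => (hc i hi).2.2.1)
    (fun i hi => (hc i hi).2.2.2) hx fun i hi j hj => hrs j hj i hi

end Pairs

end ECP

/-! ### The main theorem -/

theorem theorem6p2 {F K : Type*} [Field F] [Finite F] [Field K] [Algebra F K]
    [FiniteDimensional F K] (n t : ℕ) (ht : 1 ≤ t) (htn : (t : ℚ) ≤ n / 2 - 1)
    (C : Submodule F (Fin n → F)) (hC : ECP.IsCode C (n - 2 * t) (2 * t + 1))
    (A B : Submodule K (Fin n → K)) (hAB : ECP.IsErrorCorrectingPair t A B C) :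
    ∃ a : Fin n → OnePoint F,
      ECP.IsGRSWith C a ∧
      ECP.IsGRSWith A (fun i => (a i).map (algebraMap F K)) ∧
      ECP.IsGRSWith B (fun i => (a i).map (algebraMap F K)) ∧
      B = ECP.dualCode (A * ECP.extend K C) := by
  have hn : 2 * t + 2 ≤ n := by
    have : (2 * t + 2 : ℚ) ≤ n := by linarith
    exact_mod_cast this
  obtain ⟨k, rfl⟩ : ∃ k, n = k + 2 * t := ⟨n - 2 * t, by omega⟩
  have hk : 2 ≤ k := by omega
  rw [Nat.add_sub_cancel] at hC
  have hCM : ECP.IsMDS C k := ⟨hC.1, by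
    have := ECP.isSep_of_lt_minDist (X := C) (m := 2 * t) (by rw [hC.2]; omega)
    rwa [Nat.add_sub_cancel] at this⟩
  have hE : ECP.IsSep (ECP.dualCode B) (k + t) := by
    have := ECP.isSep_of_lt_minDist hAB.lt_minDist_dual
    rwa [show k + 2 * t - t = k + t by omega] at this
  have hperm : ∀ x y z : Fin (k + 2 * t) → K, (x * y) ⬝ᵥ z = (x * z) ⬝ᵥ y := fun x y z =>
    Finset.sum_congr rfl fun i _ => by simp only [Pi.mul_apply]; ring
  have hAC : ∀ x ∈ A, ∀ c ∈ C, x * ECP.embed F K c ∈ ECP.dualCode B := fun x hx c hc y hy => by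
    rw [hperm]
    exact hAB.mul_perp _ (Submodule.mul_mem_mul hx hy) c hc
  have hAM : ECP.IsMDS A (t + 1) := by
    have hs : ECP.IsSep A (t + 1) :=
      ECP.isSep_of_mul_embed_mem hCM (by omega) hE hAC (by omega) (by omega)
    exact ⟨le_antisymm (hs.finrank_le (by omega)) hAB.lt_finrank, hs⟩
  have hE' : ECP.IsSep (ECP.dualCode A) (k + t - 1) := by
    have := hAM.isSep_dualCode (by omega)
    rwa [show k + 2 * t - (t + 1) = k + t - 1 by omega] at this
  have hmem : ∀ x ∈ A, ∀ c ∈ C, x * ECP.embed F K c ∈ A * ECP.extend K C := fun x hx c hc =>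
    Submodule.mul_mem_mul hx (Submodule.subset_span ⟨c, hc, rfl⟩)
  have hBC' : ∀ y ∈ ECP.dualCode (A * ECP.extend K C), ∀ c ∈ C,
      y * ECP.embed F K c ∈ ECP.dualCode A := fun y hy c hc x hx => by
    have := hy _ (hmem x hx c hc)
    rwa [dotProduct_comm, hperm, mul_comm x, hperm] at this
  have hle : B ≤ ECP.dualCode (A * ECP.extend K C) := by
    intro y hy z hz
    have : A * ECP.extend K C ≤ ECP.dualCode B := by
      rw [Submodule.mul_le]
      intro x hx z hz
      induction hz using Submodule.span_induction with
      | mem z hz =>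
        obtain ⟨c, hc, rfl⟩ := hz
        exact hAC x hx c hc
      | zero => rw [mul_zero]; exact zero_mem _
      | add z z' _ _ h h' => rw [mul_add]; exact add_mem h h'
      | smul r z _ h => rw [mul_smul_comm]; exact Submodule.smul_mem _ _ h
    rw [dotProduct_comm]
    exact this hz y hy
  have hs' : ECP.IsSep (ECP.dualCode (A * ECP.extend K C)) t :=
    ECP.isSep_of_mul_embed_mem hCM (by omega) hE' hBC' (by omega) (by omega)
  -- Separation bounds the dimension of `dualCode B` by k + t = n - t.
  have hBt : t ≤ Module.finrank K B := by
    have h1 := ECP.le_finrank_add_finrank_dualCode B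
    have h2 := hE.finrank_le (by omega)
    omega
  have hBeq : B = ECP.dualCode (A * ECP.extend K C) :=
    Submodule.eq_of_le_of_finrank_le hle ((hs'.finrank_le (by omega)).trans hBt)
  rw [← hBeq] at hs' hBC'
  have hBM : ECP.IsMDS B t := ⟨le_antisymm (hs'.finrank_le (by omega)) hBt, hs'⟩
  obtain ⟨a, ha, b, hb, rfl⟩ := hCM.exists_eq_GRS_of_mul_embed_mem hk ht rfl hAM hE hAC
  refine ⟨a, ⟨ha, k, by omega, b, hb, rfl⟩, ?_, ?_, hBeq⟩
  -- A multiplies C into `dualCode B`, and B multiplies C into `dualCode A`.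
  · exact ECP.isGRSWith_of_mul_embed_mem ha hb hk (by omega) (by omega) hAM
      (by rwa [show t + 1 + k - 1 = k + t by omega]) hAC
  · exact ECP.isGRSWith_of_mul_embed_mem ha hb hk ht (by omega) hBM
      (by rwa [add_comm t k]) hBC'
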